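/- \textbf{Theorem (Tate).} Let $G$ be a finite group and let $C$ be a $G$-module (an abelian group with an additive action of $G$). Suppose that for every subgroup $H \le G$ one has $H^1(H,C)=0$ and $H^2(H,C)\cong \mathbb{Z}/|H|\mathbb{Z}$ as abelian groups. Then for every integer $r$ there is an isomorphism of abelian groups $$H_T^r(G,\mathbb{Z}) \cong H_T^{r+2}(G,C),$$ where $G$ acts trivially on $\mathbb{Z}$. Here, for a $G$-module $M$, with $\mathrm{Nm}_G : M \to M$, $a \mapsto \sum_{g\in G} g\cdot a$, and $I_G M$ the subgroup of $M$ generated by the elements $g\cdot a-a$, the Tate cohomology groups are $H_T^r(G,M)=H^r(G,M)$ for $r>0$, $H_T^0(G,M)=M^G/\mathrm{Nm}_G(M)$, $H_T^{-1}(G,M)=\ker(\mathrm{Nm}_G)/I_G M$, and $H_T^r(G,M)=H_{-(r+1)}(G,M)$ for $r<-1$. -/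

import Mathlib

open CategoryTheory Limits

universe u

/-! ### Vanishing of Tate cohomology in terms of elements. -/

section Characterizations

variable {k G : Type u} [CommRing k] [Group G] [Fintype G] (M : Rep.{u} k G)

/-! Every module embeds in, and is a quotient of, a module without Tate cohomology over any
subgroup, so degrees can be shifted. Shifting `C` twice gives `D` with H⁻¹(H,D) = 0 and H⁰(H,D)
cyclic of order |H| for all H. An invariant x whose class generates H⁰(G,D) defines a map ℤ → D.
Since the norm from H to G multiplies by the index, the class of x over H still has order |H|, so ℤ
→ D is an isomorphism on H⁰ over every subgroup (`isIso_map_res_ofInvariant`).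

Adding a cohomologically trivial summand to D makes the map injective. As H¹(H,ℤ) = 0 = H⁻¹(H,D),
the cokernel has no cohomology in degrees -1 and 0 over any subgroup. Vanishing in two consecutive
degrees over all subgroups forces vanishing in every degree (`isZero_of_vanishesHereditarily`), so
the map is an isomorphism in all degrees.

That criterion reduces to Sylow subgroups, then uses induction on the order of a p-group: if the
cohomology over a normal N with cyclic quotient vanishes, vanishing over G is 2-periodic in the
degree. -/

lemma isZero_tateCohomology_iff_exact {i j l : ℤ} (hij : i + 1 = j) (hjl : j + 1 = l) :
    IsZero (tateCohomology M j) ↔ ∀ x, (tateComplex M).d j l x = 0 →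
      ∃ y, (tateComplex M).d i j y = x := by
  refine Iff.trans ?_ (ShortComplex.moduleCat_exact_iff (S := (tateComplex M).sc' i j l))
  rw [← HomologicalComplex.exactAt_iff' _ i j l (by simp; omega) (by simp; omega),
    HomologicalComplex.exactAt_iff_isZero_homology]
  rfl

/-- The degree `0` term of the Tate complex of `M` is `M`. -/
noncomputable def tateXZero : M.V ≃ₗ[k] (tateComplex M).X 0 :=
  (groupCohomology.cochainsIso₀ M).symm.toLinearEquiv

/-- The degree `1` term of the Tate complex of `M` consists of the functions `G → M`. -/
noncomputable def tateXOne : (G → M.V) ≃ₗ[k] (tateComplex M).X 1 :=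
  (groupCohomology.cochainsIso₁ M).symm.toLinearEquiv

/-- The degree `-1` term of the Tate complex of `M` is `M`. -/
noncomputable def tateXNegOne : M.V ≃ₗ[k] (tateComplex M).X (-1) :=
  (groupHomology.chainsIso₀ M).symm.toLinearEquiv

/-- The degree `-2` term of the Tate complex of `M` consists of the finitely supported functions
`G →₀ M`. -/
noncomputable def tateXNegTwo : (G →₀ M.V) ≃ₗ[k] (tateComplex M).X (-2) :=
  (groupHomology.chainsIso₁ M).symm.toLinearEquiv

lemma tateComplex_d_tateXNegTwo (z : G →₀ M.V) :
    (tateComplex M).d (-2) (-1) (tateXNegTwo M z) = tateXNegOne M (groupHomology.d₁₀ M z) :=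
  groupHomology.eq_d₁₀_comp_inv_apply M z

lemma tateComplex_d_tateXNegOne (x : M.V) :
    (tateComplex M).d (-1) 0 (tateXNegOne M x) = tateXZero M (M.ρ.norm x) := by
  change (groupCohomology.cochainsIso₀ M).inv (M.ρ.norm ((groupHomology.chainsIso₀ M).hom
    ((groupHomology.chainsIso₀ M).inv x))) = (groupCohomology.cochainsIso₀ M).inv (M.ρ.norm x)
  simp

lemma tateComplex_d_tateXZero (x : M.V) :
    (tateComplex M).d 0 1 (tateXZero M x) = tateXOne M (groupCohomology.d₀₁ M x) :=
  groupCohomology.eq_d₀₁_comp_inv_apply M x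

lemma tateComplex_d_tateXZero_eq_zero_iff (x : M.V) :
    (tateComplex M).d 0 1 (tateXZero M x) = 0 ↔ ∀ g, M.ρ g x = x := by
  rw [tateComplex_d_tateXZero, EmbeddingLike.map_eq_zero_iff, funext_iff]
  simp [groupCohomology.d₀₁_hom_apply, sub_eq_zero]

lemma isZero_tateCohomology_zero_iff :
    IsZero (tateCohomology M 0) ↔
      ∀ x, (∀ g, M.ρ g x = x) → ∃ y, M.ρ.norm y = x := by
  rw [isZero_tateCohomology_iff_exact M (i := -1) (l := 1) (by simp) (by simp)]
  simp_rw [(tateXZero M).surjective.forall, (tateXNegOne M).surjective.exists,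
    tateComplex_d_tateXNegOne, tateComplex_d_tateXZero_eq_zero_iff, EmbeddingLike.apply_eq_iff_eq]

lemma isZero_tateCohomology_neg_one_iff :
    IsZero (tateCohomology M (-1)) ↔
      ∀ x, M.ρ.norm x = 0 → x ∈ Representation.Coinvariants.ker M.ρ := by
  rw [isZero_tateCohomology_iff_exact M (i := -2) (l := 0) (by simp) (by simp)]
  simp_rw [(tateXNegOne M).surjective.forall, (tateXNegTwo M).surjective.exists,
    tateComplex_d_tateXNegOne, tateComplex_d_tateXNegTwo, EmbeddingLike.apply_eq_iff_eq,
    EmbeddingLike.map_eq_zero_iff, ← groupHomology.range_d₁₀_eq_coinvariantsKer]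
  rfl

lemma isZero_tateCohomology_one_iff :
    IsZero (tateCohomology M 1) ↔
      ∀ f : G → M, (∀ g h, f (g * h) = M.ρ g (f h) + f g) → ∃ x, ∀ g, f g = M.ρ g x - x := by
  refine ((TateCohomology.isoGroupCohomology 1).app M).isZero_iff.trans ?_
  change IsZero (groupCohomology M 1) ↔ _
  rw [ModuleCat.isZero_iff_subsingleton]
  constructor
  · intro h f hf
    obtain ⟨x, hx⟩ := (groupCohomology.H1π_eq_zero_iff
      ⟨f, (groupCohomology.mem_cocycles₁_iff f).2 hf⟩).1 (Subsingleton.elim _ _)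
    exact ⟨x, fun g ↦ (congrFun hx g).symm⟩
  · intro h
    refine subsingleton_of_forall_eq 0 fun y ↦ ?_
    induction y using groupCohomology.H1_induction_on with | @h f =>
    obtain ⟨x, hx⟩ := h f ((groupCohomology.mem_cocycles₁_iff f).1 f.2)
    exact (groupCohomology.H1π_eq_zero_iff f).2 ⟨x, funext fun g ↦ (hx g).symm⟩

lemma isZero_tateCohomology_ofNat_iff (n : ℕ) :
    IsZero (tateCohomology M ((n + 1 : ℕ) : ℤ)) ↔
      ∀ x, inhomogeneousCochains.d M (n + 1) x = 0 → ∃ y, inhomogeneousCochains.d M n y = x := by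
  rw [isZero_tateCohomology_iff_exact M (i := n) (l := (n + 1 + 1 : ℕ)) (by simp) (by simp)]
  rw [← groupCohomology.inhomogeneousCochains.d_def, ← groupCohomology.inhomogeneousCochains.d_def]
  rfl

lemma isZero_tateCohomology_negSucc_iff (n : ℕ) :
    IsZero (tateCohomology M (.negSucc (n + 1))) ↔
      ∀ x, groupHomology.inhomogeneousChains.d M n x = 0 →
        ∃ y, groupHomology.inhomogeneousChains.d M (n + 1) y = x := by
  rw [isZero_tateCohomology_iff_exact M (i := .negSucc (n + 2)) (l := .negSucc n) (by grind) (by grind)]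
  rw [← groupHomology.inhomogeneousChains.d_def, ← groupHomology.inhomogeneousChains.d_def]
  rfl

end Characterizations

/-! ### Weakly projective representations and their cohomological triviality. -/

lemma Fin.contractNth_zero_cons {α : Type*} {n : ℕ} (op : α → α → α) (a : α) (g : Fin (n + 1) → α) :
    Fin.contractNth 0 op (Fin.cons a g : Fin (n + 2) → α) = Fin.cons (op a (g 0)) (Fin.tail g) := by
  ext i
  refine Fin.cases ?_ (fun i ↦ ?_) i
  · simp [Fin.contractNth]
  · simp [Fin.contractNth, Fin.tail]

lemma Fin.contractNth_succ_cons {α : Type*} {n : ℕ} (op : α → α → α) (a : α) (g : Fin (n + 1) → α)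
    (j : Fin (n + 1)) :
    Fin.contractNth j.succ op (Fin.cons a g : Fin (n + 2) → α) =
      Fin.cons a (Fin.contractNth j op g) := by
  ext i
  refine Fin.cases ?_ (fun i ↦ ?_) i
  · simp [Fin.contractNth]
  · simp only [Fin.contractNth, Fin.cons_succ, Fin.val_succ, Nat.succ_lt_succ_iff,
      Nat.succ_inj, Fin.castSucc_succ]

namespace Representation

variable {k G V : Type*} [CommRing k] [Group G] [Fintype G] [AddCommGroup V] [Module k V]

/-- A representation of a finite group is weakly projective if its identity is the norm of a linear
endomorphism. -/
def IsWeaklyProjective (ρ : Representation k G V) : Prop :=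
  ∃ φ : V →ₗ[k] V, ∀ x, ∑ g, ρ g (φ (ρ g⁻¹ x)) = x

/-- Sum the conjugates of φ over right coset representatives of H; the norm over H of this
endomorphism is the norm of φ over G. -/
lemma IsWeaklyProjective.comp {ρ : Representation k G V} (h : ρ.IsWeaklyProjective)
    {H : Type*} [Group H] [Fintype H] {f : H →* G} (hf : Function.Injective f) :
    IsWeaklyProjective (ρ.comp f) := by
  obtain ⟨φ, hφ⟩ := h
  obtain ⟨T, hT, -⟩ := f.range.exists_isComplement_right 1
  classical
  have := Fintype.ofFinite T
  refine ⟨∑ t : T, ρ t ∘ₗ φ ∘ₗ ρ (t : G)⁻¹, fun x ↦ ?_⟩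
  have hb : Function.Bijective fun p : H × T ↦ f p.1 * (p.2 : G) := by
    exact Function.Bijective.comp hT
      ((MonoidHom.ofInjective hf).bijective.prodMap Function.bijective_id)
  have h := hφ x
  rw [← hb.sum_comp (fun g ↦ ρ g (φ (ρ g⁻¹ x))), Fintype.sum_prod_type] at h
  simpa using h

lemma IsWeaklyProjective.of_subsingleton [Subsingleton G] (ρ : Representation k G V) :
    ρ.IsWeaklyProjective := by
  refine ⟨LinearMap.id, fun x ↦ ?_⟩
  have : Unique G := ⟨⟨1⟩, fun _ ↦ Subsingleton.elim _ _⟩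
  simp

end Representation

section Vanishing

variable {k G : Type u} [CommRing k] [Group G] [Fintype G] {M : Rep.{u} k G}

namespace Representation.IsWeaklyProjective

/-- The cocycle identity at (a⁻¹, g), pushed through φ, moved by a and summed over a, writes x as an
explicit coboundary. -/
lemma isZero_tateCohomology_ofNat (hM : M.ρ.IsWeaklyProjective) (n : ℕ) :
    IsZero (tateCohomology M ((n + 1 : ℕ) : ℤ)) := by
  obtain ⟨φ, hφ⟩ := hM
  rw [isZero_tateCohomology_ofNat_iff]
  intro x hx
  refine ⟨fun g ↦ ∑ a, M.ρ a (φ (x (Fin.cons a⁻¹ g))), ?_⟩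
  funext g
  have hx' (a : G) : M.ρ a⁻¹ (x g) - x (Fin.cons (a⁻¹ * g 0) (Fin.tail g)) -
      ∑ j : Fin (n + 1), (-1 : k) ^ ((j : ℕ) + 1) •
        x (Fin.cons a⁻¹ (Fin.contractNth j (· * ·) g)) = 0 := by
    have : (inhomogeneousCochains.d M (n + 1)).hom x (Fin.cons a⁻¹ g) = 0 :=
      congrFun hx (Fin.cons a⁻¹ g)
    erw [inhomogeneousCochains.d_hom_apply] at this
    rw [Fin.sum_univ_succ] at this
    simp only [Fin.contractNth_zero_cons, Fin.contractNth_succ_cons, Fin.cons_zero,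
      Fin.cons_succ, Fin.val_zero, Fin.val_succ, pow_succ _ (_ + 1)] at this
    simpa [sub_eq_add_neg, add_assoc] using this
  have hsum : ∑ a, M.ρ a (φ (M.ρ a⁻¹ (x g) - x (Fin.cons (a⁻¹ * g 0) (Fin.tail g)) -
      ∑ j : Fin (n + 1), (-1 : k) ^ ((j : ℕ) + 1) •
        x (Fin.cons a⁻¹ (Fin.contractNth j (· * ·) g)))) = 0 := by
    simp [hx']
  simp only [map_sub, Finset.sum_sub_distrib, hφ] at hsum
  erw [inhomogeneousCochains.d_hom_apply]
  rw [sub_sub, sub_eq_zero] at hsum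
  refine Eq.trans ?_ hsum.symm
  congr 1
  · rw [← (Group.mulLeft_bijective (g 0)).sum_comp (fun a ↦ M.ρ a (φ (x (Fin.cons (a⁻¹ * g 0) _))))]
    simp [Fin.tail_def]
  · simp only [map_sum, map_smul, Finset.smul_sum]
    rw [Finset.sum_comm]

lemma isZero_tateCohomology_negSucc (hM : M.ρ.IsWeaklyProjective) (n : ℕ) :
    IsZero (tateCohomology M (.negSucc (n + 1))) := by
  obtain ⟨φ, hφ⟩ := hM
  rw [isZero_tateCohomology_negSucc_iff]
  let s (m : ℕ) : ((Fin m → G) →₀ M.V) →ₗ[k] ((Fin (m + 1) → G) →₀ M.V) :=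
    Finsupp.lsum k fun g ↦ ∑ a, Finsupp.lsingle (Fin.cons a g) ∘ₗ φ ∘ₗ M.ρ a
  have hs (m : ℕ) (g : Fin m → G) (v : M.V) :
      s m (Finsupp.single g v) = ∑ a, Finsupp.single (Fin.cons a g) (φ (M.ρ a v)) := by
    simp [s]
  -- `s` is a contracting homotopy: the face of (a, g) deleting a recovers g by weak projectivity,
  -- and the remaining faces cancel against s ∘ d.
  have key : (groupHomology.inhomogeneousChains.d M (n + 1)).hom ∘ₗ s (n + 1) +
      s n ∘ₗ (groupHomology.inhomogeneousChains.d M n).hom = LinearMap.id := by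
    refine Finsupp.lhom_ext fun g v ↦ ?_
    have hφ' : ∑ a, M.ρ a⁻¹ (φ (M.ρ a v)) = v := by
      rw [← (Equiv.inv G).bijective.sum_comp]
      simpa using hφ v
    have h1 : (groupHomology.inhomogeneousChains.d M (n + 1)).hom (s (n + 1) (Finsupp.single g v)) =
        Finsupp.single g v - ∑ a, Finsupp.single (Fin.cons (a * g 0) (Fin.tail g)) (φ (M.ρ a v)) -
        ∑ j : Fin (n + 1), (-1 : k) ^ ((j : ℕ) + 1) •
          s n (Finsupp.single (Fin.contractNth j (· * ·) g) v) := by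
      rw [hs, map_sum]
      have (a : G) : (groupHomology.inhomogeneousChains.d M (n + 1)).hom
          (Finsupp.single (Fin.cons a g) (φ (M.ρ a v))) = Finsupp.single g (M.ρ a⁻¹ (φ (M.ρ a v))) -
          Finsupp.single (Fin.cons (a * g 0) (Fin.tail g)) (φ (M.ρ a v)) -
          ∑ j : Fin (n + 1), (-1 : k) ^ ((j : ℕ) + 1) •
            Finsupp.single (Fin.cons a (Fin.contractNth j (· * ·) g)) (φ (M.ρ a v)) := by
        erw [groupHomology.inhomogeneousChains.d_single]
        rw [Fin.sum_univ_succ]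
        simp only [Fin.contractNth_zero_cons, Fin.contractNth_succ_cons, Fin.cons_zero,
          Fin.cons_succ, Fin.val_zero, Fin.val_succ, pow_succ _ (_ + 1)]
        simp [sub_eq_add_neg, add_assoc]
      simp only [this, Finset.sum_sub_distrib, hs, Finset.smul_sum]
      rw [Finset.sum_comm, ← Finsupp.single_finsetSum, hφ']
    have h2 : s n ((groupHomology.inhomogeneousChains.d M n).hom (Finsupp.single g v)) =
        ∑ a, Finsupp.single (Fin.cons (a * g 0) (Fin.tail g)) (φ (M.ρ a v)) +
        ∑ j : Fin (n + 1), (-1 : k) ^ ((j : ℕ) + 1) •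
          s n (Finsupp.single (Fin.contractNth j (· * ·) g) v) := by
      erw [groupHomology.inhomogeneousChains.d_single]
      rw [map_add, map_sum, hs]
      congr 1
      · rw [← (Group.mulRight_bijective (g 0)).sum_comp]
        simp [Fin.tail_def]
      · simp only [map_smul]
    rw [LinearMap.add_apply, LinearMap.comp_apply, LinearMap.comp_apply, h1, h2]
    simp
  intro x hx
  refine ⟨s (n + 1) x, ?_⟩
  have := LinearMap.congr_fun key x
  rw [LinearMap.add_apply, LinearMap.comp_apply, LinearMap.comp_apply] at this
  erw [hx] at this
  simpa using this

theorem isZero_tateCohomology (hM : M.ρ.IsWeaklyProjective) (r : ℤ) :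
    IsZero (tateCohomology M r) := by
  match r with
  | .ofNat (n + 1) => exact hM.isZero_tateCohomology_ofNat n
  | .negSucc (n + 1) => exact hM.isZero_tateCohomology_negSucc n
  | .ofNat 0 =>
    obtain ⟨φ, hφ⟩ := hM
    refine (isZero_tateCohomology_zero_iff M).2 fun x hx ↦ ⟨φ x, ?_⟩
    simpa [hx, Representation.norm] using hφ x
  | .negSucc 0 =>
    obtain ⟨φ, hφ⟩ := hM
    refine (isZero_tateCohomology_neg_one_iff M).2 fun x hx ↦ ?_
    have h0 : ∑ g, φ (M.ρ g⁻¹ x) = 0 := by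
      refine ((Equiv.inv G).bijective.sum_comp (fun g ↦ φ (M.ρ g x))).trans ?_
      rw [← map_sum]
      rw [Representation.norm, LinearMap.sum_apply] at hx
      rw [hx, map_zero]
    -- x is the sum of the differences g·φ(g⁻¹x) - φ(g⁻¹x), because the subtracted terms add up to φ
    -- of the norm of x.
    rw [← hφ x, ← sub_zero (∑ g, _), ← h0, ← Finset.sum_sub_distrib]
    exact Submodule.sum_mem _ fun g _ ↦ Coinvariants.sub_mem_ker g _

end Representation.IsWeaklyProjective

end Vanishing

/-! ### Dimension shifting. -/

namespace TateCohomology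

variable {k G : Type u} [CommRing k] [Group G]

section Shift

lemma isIso_δ [Fintype G] {S : ShortComplex (Rep.{u} k G)} (hS : S.ShortExact)
    (h : S.X₂.ρ.IsWeaklyProjective) (r : ℤ) : IsIso (δ hS r) :=
  (map_tateComplexFunctor_shortExact hS).isIso_δ r (r + 1) rfl
    (h.isZero_tateCohomology r) (h.isZero_tateCohomology (r + 1))

/-- The functions `G → M` with the diagonal action of `G`. -/
def diagonalFunctions (M : Rep.{u} k G) : Rep.{u} k G :=
  Rep.of (X := G → M.V)
    { toFun g :=
        { toFun F x := M.ρ g (F (g⁻¹ * x))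
          map_add' F F' := by ext; simp
          map_smul' c F := by ext; simp }
      map_one' := by ext; simp
      map_mul' g h := by ext; simp [mul_assoc] }

lemma diagonalFunctions_ρ_apply (M : Rep.{u} k G) (g : G) (F : G → M.V) (x : G) :
    (diagonalFunctions M).ρ g F x = M.ρ g (F (g⁻¹ * x)) := rfl

lemma isWeaklyProjective_diagonalFunctions [Fintype G] (M : Rep.{u} k G) :
    (diagonalFunctions M).ρ.IsWeaklyProjective := by
  classical
  -- Restriction to the support {1}; its conjugates are the restrictions to the other points of G.
  refine ⟨LinearMap.single k (fun _ ↦ M.V) 1 ∘ₗ LinearMap.proj 1, fun F ↦ ?_⟩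
  refine funext fun x ↦ ?_
  refine (Finset.sum_apply x _ _).trans ?_
  rw [Finset.sum_eq_single x]
  · change M.ρ x ((Pi.single 1 (M.ρ x⁻¹ (F (x⁻¹⁻¹ * 1))) : G → M.V) (x⁻¹ * x)) = F x
    simp
  · intro g _ hg
    change M.ρ g ((Pi.single 1 (M.ρ g⁻¹ (F (g⁻¹⁻¹ * 1))) : G → M.V) (g⁻¹ * x)) = 0
    have : g⁻¹ * x ≠ 1 := by rwa [ne_eq, inv_mul_eq_one]
    simp [this]
  · simp

/-- The inclusion of `M` as the constant functions. -/
def diagonalConst (M : Rep.{u} k G) : M ⟶ diagonalFunctions M :=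
  Rep.ofHom ⟨LinearMap.pi fun _ ↦ LinearMap.id, fun g ↦ by ext; rfl⟩

/-- The sum of the values of a function. -/
def diagonalSum [Fintype G] (M : Rep.{u} k G) : diagonalFunctions M ⟶ M :=
  Rep.ofHom ⟨∑ x, LinearMap.proj x, fun g ↦ by
    ext F
    simpa [diagonalFunctions_ρ_apply] using
      (Group.mulLeft_bijective g⁻¹).sum_comp (fun x ↦ M.ρ g (F x))⟩

instance (M : Rep.{u} k G) : Mono (diagonalConst M) :=
  (Rep.mono_iff_injective _).2 fun _ _ h ↦ congrFun h 1

instance [Fintype G] (M : Rep.{u} k G) : Epi (diagonalSum M) :=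
  (Rep.epi_iff_surjective _).2 fun m ↦ by
    classical
    refine ⟨(Pi.single 1 m : G → M.V), ?_⟩
    change (∑ x, LinearMap.proj x : (G → M.V) →ₗ[k] M.V) (Pi.single 1 m) = m
    simp

/-- The cokernel of the embedding of `M` into a weakly projective representation. -/
noncomputable def cosyzygy (M : Rep.{u} k G) : Rep.{u} k G := cokernel (diagonalConst M)

/-- The kernel of a surjection of a weakly projective representation onto `M`. -/
noncomputable def syzygy [Fintype G] (M : Rep.{u} k G) : Rep.{u} k G := kernel (diagonalSum M)

variable [Fintype G] {H : Type u} [Group H] [Fintype H] {f : H →* G}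

lemma nonempty_iso_of_shortExact {S : ShortComplex (Rep.{u} k G)} (hS : S.ShortExact)
    (h : S.X₂.ρ.IsWeaklyProjective) (hf : Function.Injective f) {r s : ℤ} (hrs : r + 1 = s) :
    Nonempty (tateCohomology (Rep.res f S.X₃) r ≅ tateCohomology (Rep.res f S.X₁) s) := by
  subst hrs
  have hS' := (Rep.shortExact_res f).2 hS
  exact ⟨@asIso _ _ _ _ _ (isIso_δ hS' (h.comp hf) r)⟩

lemma nonempty_iso_cosyzygy (M : Rep.{u} k G) (hf : Function.Injective f) {r s : ℤ}
    (hrs : r + 1 = s) :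
    Nonempty (tateCohomology (Rep.res f (cosyzygy M)) r ≅ tateCohomology (Rep.res f M) s) :=
  nonempty_iso_of_shortExact (S := ShortComplex.mk _ _ (cokernel.condition (diagonalConst M)))
    { exact := ShortComplex.exact_cokernel _ } (isWeaklyProjective_diagonalFunctions M) hf hrs

lemma nonempty_iso_syzygy (M : Rep.{u} k G) (hf : Function.Injective f) {r s : ℤ}
    (hrs : r + 1 = s) :
    Nonempty (tateCohomology (Rep.res f M) r ≅ tateCohomology (Rep.res f (syzygy M)) s) :=
  nonempty_iso_of_shortExact (S := ShortComplex.mk _ _ (kernel.condition (diagonalSum M)))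
    { exact := ShortComplex.exact_kernel _ } (isWeaklyProjective_diagonalFunctions M) hf hrs

lemma isZero_cosyzygy_iff (M : Rep.{u} k G) (hf : Function.Injective f) {r s : ℤ}
    (hrs : r + 1 = s) :
    IsZero (tateCohomology (Rep.res f (cosyzygy M)) r) ↔ IsZero (tateCohomology (Rep.res f M) s) :=
  (nonempty_iso_cosyzygy M hf hrs).some.isZero_iff

lemma isZero_syzygy_iff (M : Rep.{u} k G) (hf : Function.Injective f) {r s : ℤ}
    (hrs : r + 1 = s) :
    IsZero (tateCohomology (Rep.res f M) r) ↔ IsZero (tateCohomology (Rep.res f (syzygy M)) s) :=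
  (nonempty_iso_syzygy M hf hrs).some.isZero_iff

/-- Dimension shifting for properties of representations. -/
lemma dimension_shift {P : Rep.{u} k G → ℤ → Prop} (r₀ : ℤ) (h₀ : ∀ M, P M r₀)
    (hco : ∀ M r, P (cosyzygy M) r → P M (r + 1))
    (hsy : ∀ M r, P (syzygy M) (r + 1) → P M r) (M : Rep.{u} k G) (r : ℤ) : P M r := by
  induction r using Int.inductionOn' (b := r₀) generalizing M with
  | zero => exact h₀ M
  | succ r _ ih => exact hco M r (ih _)
  | pred r _ ih => exact hsy M (r - 1) (by simpa using ih (syzygy M))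

end Shift

end TateCohomology

/-! ### Norms, cocycles and coinvariants for cyclic quotients and Sylow subgroups. -/

namespace Representation

variable {k G V : Type*} [CommRing k] [Group G] [AddCommGroup V] [Module k V]
  (ρ : Representation k G V)

lemma cocycle_pow {f : G → V} (hf : ∀ g h, f (g * h) = ρ g (f h) + f g) (σ : G) (n : ℕ) :
    f (σ ^ n) = ∑ i ∈ Finset.range n, ρ (σ ^ i) (f σ) := by
  induction n with
  | zero => simpa using hf 1 1
  | succ n ih => rw [pow_succ, hf, Finset.sum_range_succ, ih, add_comm]

lemma sum_range_pow_add (σ : G) (v : V) (m n : ℕ) :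
    ∑ i ∈ Finset.range (m + n), ρ (σ ^ i) v =
      ∑ i ∈ Finset.range m, ρ (σ ^ i) v + ρ (σ ^ m) (∑ i ∈ Finset.range n, ρ (σ ^ i) v) := by
  simp [Finset.sum_range_add, pow_add]

lemma apply_sum_range_pow_sub (σ : G) (v : V) (n : ℕ) :
    ρ σ (∑ i ∈ Finset.range n, ρ (σ ^ i) v) - ∑ i ∈ Finset.range n, ρ (σ ^ i) v =
      ρ (σ ^ n) v - v := by
  have h1 := ρ.sum_range_pow_add σ v 1 n
  have h2 := ρ.sum_range_pow_add σ v n 1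
  rw [add_comm n 1, h1] at h2
  simp only [Finset.sum_range_one, pow_zero, pow_one, map_one, Module.End.one_apply] at h2
  rw [sub_eq_sub_iff_add_eq_add, add_comm _ v, h2, add_comm]

lemma apply_eq_of_mk_eq {N : Subgroup G} {v : V} (hv : ∀ n ∈ N, ρ n v = v) {g h : G}
    (hgh : (g : G ⧸ N) = h) : ρ g v = ρ h v := by
  have := hv _ (QuotientGroup.eq.1 hgh)
  rw [map_mul, Module.End.mul_apply] at this
  rw [← this, ← Module.End.mul_apply, ← map_mul]
  simp [this]

section Normal

variable {N : Subgroup G} [N.Normal]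

lemma apply_mem_invariants_of_normal {v : V} (hv : ∀ n ∈ N, ρ n v = v) (g : G) :
    ∀ n ∈ N, ρ n (ρ g v) = ρ g v := fun n hn ↦ by
  have := hv (g⁻¹ * n * g) (by simpa using ‹N.Normal›.conj_mem n hn g⁻¹)
  calc ρ n (ρ g v) = ρ g (ρ (g⁻¹ * n * g) v) := by
        rw [← Module.End.mul_apply, ← Module.End.mul_apply, ← map_mul, ← map_mul]; group
    _ = _ := by rw [this]

lemma norm_subgroup_apply [Fintype N] (g : G) (v : V) :
    norm (ρ.comp N.subtype) (ρ g v) = ρ g (norm (ρ.comp N.subtype) v) := by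
  simp only [norm, LinearMap.sum_apply, map_sum]
  refine Fintype.sum_bijective (MulAut.conjNormal g⁻¹) (MulAut.conjNormal g⁻¹).bijective _ _
    fun n ↦ ?_
  simp only [MonoidHom.comp_apply, Subgroup.coe_subtype, MulAut.conjNormal_apply, inv_inv,
    ← Module.End.mul_apply, ← map_mul]
  group

variable [Fintype G] {σ : G}

lemma exists_mk_eq_pow (hσ : ∀ x : G ⧸ N, x ∈ Subgroup.zpowers (σ : G ⧸ N)) (g : G) :
    ∃ i : ℕ, (g : G ⧸ N) = ((σ ^ i : G) : G ⧸ N) := by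
  obtain ⟨i, hi⟩ := (mem_powers_iff_mem_zpowers).2 (hσ g)
  exact ⟨i, hi.symm⟩

variable [Fintype N]

lemma norm_eq_sum_range (hσ : ∀ x : G ⧸ N, x ∈ Subgroup.zpowers (σ : G ⧸ N)) (v : V) :
    norm ρ v = ∑ i ∈ Finset.range (orderOf (σ : G ⧸ N)),
      ρ (σ ^ i) (norm (ρ.comp N.subtype) v) := by
  have hcard : orderOf (σ : G ⧸ N) * Fintype.card N = Fintype.card G := by
    rw [orderOf_eq_card_of_forall_mem_zpowers hσ, ← Nat.card_eq_fintype_card,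
      ← Nat.card_eq_fintype_card, ← Subgroup.index_eq_card, N.index_mul_card]
  have hb : Function.Bijective
      fun p : Fin (orderOf (σ : G ⧸ N)) × N ↦ σ ^ (p.1 : ℕ) * (p.2 : G) := by
    rw [Fintype.bijective_iff_injective_and_card]
    refine ⟨?_, by simpa using hcard⟩
    rintro ⟨i, n⟩ ⟨j, m⟩ h
    have h' := congrArg (QuotientGroup.mk (s := N)) h
    simp only [QuotientGroup.mk_mul, QuotientGroup.mk_pow,
      (QuotientGroup.eq_one_iff (n : G)).2 n.2, (QuotientGroup.eq_one_iff (m : G)).2 m.2,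
      mul_one] at h'
    have hij : i = j := Fin.ext (pow_injOn_Iio_orderOf i.2 j.2 h')
    subst hij
    simpa using h
  rw [norm, LinearMap.sum_apply, ← hb.sum_comp, Fintype.sum_prod_type, Finset.sum_range]
  simp [norm]

variable (hσ : ∀ x : G ⧸ N, x ∈ Subgroup.zpowers (σ : G ⧸ N))

-- For gy - y with g ≡ σⁱ mod N, the norm over N is (σⁱ - 1) applied to the norm of y, which
-- telescopes as a multiple of σ - 1.
include hσ in
lemma exists_norm_eq_apply_sub {m : V} (hm : m ∈ Coinvariants.ker ρ) :
    ∃ x, (∀ n ∈ N, ρ n x = x) ∧ norm (ρ.comp N.subtype) m = ρ σ x - x := by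
  induction hm using Submodule.span_induction with
  | mem m hm =>
    obtain ⟨⟨g, y⟩, rfl⟩ := hm
    obtain ⟨i, hi⟩ := exists_mk_eq_pow hσ g
    have hinv : ∀ n ∈ N, ρ n (norm (ρ.comp N.subtype) y) = norm (ρ.comp N.subtype) y :=
      fun n hn ↦ self_norm_apply (ρ.comp N.subtype) ⟨n, hn⟩ y
    refine ⟨∑ j ∈ Finset.range i, ρ (σ ^ j) (norm (ρ.comp N.subtype) y), fun n hn ↦ ?_, ?_⟩
    · rw [map_sum]
      exact Finset.sum_congr rfl fun j _ ↦ ρ.apply_mem_invariants_of_normal hinv _ n hn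
    · rw [apply_sum_range_pow_sub, map_sub, norm_subgroup_apply, ρ.apply_eq_of_mk_eq hinv hi]
  | zero => exact ⟨0, by simp⟩
  | add a b _ _ ha hb =>
    obtain ⟨x, hx, hx'⟩ := ha
    obtain ⟨y, hy, hy'⟩ := hb
    refine ⟨x + y, fun n hn ↦ by rw [map_add, hx n hn, hy n hn], ?_⟩
    rw [map_add, hx', hy', map_add]
    abel
  | smul c a _ ha =>
    obtain ⟨x, hx, hx'⟩ := ha
    refine ⟨c • x, fun n hn ↦ by rw [map_smul, hx n hn], ?_⟩
    rw [map_smul, hx', map_smul, smul_sub]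

-- Modulo a coboundary, f vanishes on N, so f(σ) is N-invariant and equals the N-norm of some m. The
-- G-norm of m is the value of f at a power of σ lying in N, hence 0; then m lies in the
-- augmentation part and its N-norm f(σ) has the form σx - x.
include hσ in
lemma exists_cocycle_eq_of_cyclic_quotient
    (h0 : ∀ x, (∀ n ∈ N, ρ n x = x) → ∃ y, norm (ρ.comp N.subtype) y = x)
    (h1 : ∀ f : N → V, (∀ g h, f (g * h) = ρ g (f h) + f g) → ∃ x, ∀ g, f g = ρ g x - x)
    (hG : ∀ x, norm ρ x = 0 → x ∈ Coinvariants.ker ρ)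
    (f : G → V) (hf : ∀ g h, f (g * h) = ρ g (f h) + f g) : ∃ x, ∀ g, f g = ρ g x - x := by
  obtain ⟨x₀, hx₀⟩ := h1 (fun n ↦ f n) (fun g h ↦ hf g h)
  let f' (g : G) : V := f g - (ρ g x₀ - x₀)
  have hf' (g h : G) : f' (g * h) = ρ g (f' h) + f' g := by
    simp only [f', hf, map_mul, Module.End.mul_apply, map_sub]
    abel
  have hN (n : G) (hn : n ∈ N) : f' n = 0 := by simp [f', hx₀ ⟨n, hn⟩]
  have hinv : ∀ n ∈ N, ρ n (f' σ) = f' σ := fun n hn ↦ by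
    have e1 := hf' n σ
    have e2 := hf' σ (σ⁻¹ * n * σ)
    rw [hN n hn, add_zero] at e1
    rw [hN (σ⁻¹ * n * σ) (by simpa using ‹N.Normal›.conj_mem n hn σ⁻¹), map_zero, zero_add,
      show σ * (σ⁻¹ * n * σ) = n * σ by group] at e2
    rw [← e1, e2]
  obtain ⟨m, hm⟩ := h0 _ hinv
  have hm0 : norm ρ m = 0 := by
    rw [ρ.norm_eq_sum_range hσ, hm, ← ρ.cocycle_pow hf']
    refine hN _ ((QuotientGroup.eq_one_iff _).1 ?_)
    rw [QuotientGroup.mk_pow, pow_orderOf_eq_one]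
  obtain ⟨x, hx, hx'⟩ := ρ.exists_norm_eq_apply_sub hσ (hG m hm0)
  refine ⟨x + x₀, fun g ↦ ?_⟩
  obtain ⟨i, hi⟩ := exists_mk_eq_pow hσ g
  have e1 := hf' (σ ^ i) ((σ ^ i)⁻¹ * g)
  rw [hN _ (QuotientGroup.eq.1 hi.symm), map_zero, zero_add, mul_inv_cancel_left,
    ρ.cocycle_pow hf', ← hm, hx'] at e1
  have e2 : f' g = ρ g x - x := by
    rw [e1, ρ.apply_eq_of_mk_eq hx hi, ← ρ.apply_sum_range_pow_sub]
    simp only [map_sub, Finset.sum_sub_distrib, map_sum, ← Module.End.mul_apply, ← map_mul,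
      ← pow_succ, ← pow_succ']
  rw [map_add, add_sub_add_comm, ← e2]
  simp [f']

-- The converse construction: as the G-norm of m is zero, the partial sums `S` of σʲv, with v the
-- N-norm of m, depend only on the class of σⁱ mod N and form a cocycle on G. Splitting it gives v =
-- σx - x with x the N-norm of some y, so m - (σy - y) has N-norm zero.
include hσ in
lemma mem_coinvariantsKer_of_cyclic_quotient
    (h0 : ∀ x, (∀ n ∈ N, ρ n x = x) → ∃ y, norm (ρ.comp N.subtype) y = x)
    (h1 : ∀ x, norm (ρ.comp N.subtype) x = 0 → x ∈ Coinvariants.ker (ρ.comp N.subtype))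
    (hG : ∀ f : G → V, (∀ g h, f (g * h) = ρ g (f h) + f g) → ∃ x, ∀ g, f g = ρ g x - x)
    (m : V) (hm : norm ρ m = 0) : m ∈ Coinvariants.ker ρ := by
  set v := norm (ρ.comp N.subtype) m with hv
  let S (i : ℕ) : V := ∑ j ∈ Finset.range i, ρ (σ ^ j) v
  have hinv : ∀ n ∈ N, ρ n v = v := fun n hn ↦ self_norm_apply (ρ.comp N.subtype) ⟨n, hn⟩ m
  have hSinv (i : ℕ) : ∀ n ∈ N, ρ n (S i) = S i := fun n hn ↦ by
    simp only [S, map_sum]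
    exact Finset.sum_congr rfl fun j _ ↦ ρ.apply_mem_invariants_of_normal hinv _ n hn
  have hSq : S (orderOf (σ : G ⧸ N)) = 0 := by rw [← hm, ρ.norm_eq_sum_range hσ]
  have hSadd (i j : ℕ) : S (i + j) = S i + ρ (σ ^ i) (S j) := ρ.sum_range_pow_add σ v i j
  have hSmul (i : ℕ) : S (orderOf (σ : G ⧸ N) * i) = 0 := by
    induction i with
    | zero => simp [S]
    | succ i ih => rw [mul_add, mul_one, hSadd, ih, hSq, map_zero, add_zero]
  have hSmod (i : ℕ) : S i = S (i % orderOf (σ : G ⧸ N)) := by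
    conv_lhs => rw [← Nat.mod_add_div i (orderOf (σ : G ⧸ N))]
    rw [hSadd, hSmul, map_zero, add_zero]
  have hSeq {i j : ℕ} (hij : ((σ ^ i : G) : G ⧸ N) = ((σ ^ j : G) : G ⧸ N)) : S i = S j := by
    rw [QuotientGroup.mk_pow, QuotientGroup.mk_pow, pow_eq_pow_iff_modEq] at hij
    rw [hSmod i, hSmod j, hij]
  choose e he using exists_mk_eq_pow hσ
  obtain ⟨x, hx⟩ := hG (fun g ↦ S (e g)) fun g h ↦ by
    have : S (e (g * h)) = S (e g + e h) := hSeq (by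
      rw [← he, pow_add, QuotientGroup.mk_mul, QuotientGroup.mk_mul, ← he, ← he])
    rw [this, hSadd, add_comm, ρ.apply_eq_of_mk_eq (hSinv _) (he g)]
  have hxN : ∀ n ∈ N, ρ n x = x := fun n hn ↦ by
    rw [← sub_eq_zero, ← hx, hSeq (j := 0)]
    · simp [S]
    · rw [← he, pow_zero, QuotientGroup.mk_one, (QuotientGroup.eq_one_iff n).2 hn]
  have hxσ : v = ρ σ x - x := by
    rw [← hx, hSeq (j := 1)]
    · simp [S]
    · rw [← he, pow_one]
  obtain ⟨y, rfl⟩ := h0 x hxN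
  have hker := h1 (m - (ρ σ y - y)) (by
    rw [map_sub, map_sub, norm_subgroup_apply, ← hv, hxσ, sub_self])
  have hle : Coinvariants.ker (ρ.comp N.subtype) ≤ Coinvariants.ker ρ := by
    refine Submodule.span_le.2 ?_
    rintro _ ⟨⟨n, z⟩, rfl⟩
    exact Coinvariants.sub_mem_ker (n : G) z
  simpa using Submodule.add_mem _ (hle hker) (Coinvariants.sub_mem_ker σ y)

end Normal

variable [Fintype G]

/-- Summing over left cosets, each contributes x. In degree 0 this replaces the identity cor ∘ res =
index. -/
lemma norm_eq_index_nsmul {H : Type*} [Group H] [Fintype H] {f : H →* G}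
    (hf : Function.Injective f) {x y : V} (hx : ∀ g, ρ g x = x) (hy : norm (ρ.comp f) y = x) :
    norm ρ y = f.range.index • x := by
  classical
  obtain ⟨T, hT, -⟩ := f.range.exists_isComplement_left 1
  have := Fintype.ofFinite T
  have hb : Function.Bijective fun p : T × H ↦ (p.1 : G) * f p.2 :=
    Function.Bijective.comp hT
      (Function.bijective_id.prodMap (MonoidHom.ofInjective hf).bijective)
  have hc : ∀ t : T, ∑ h, ρ ((t : G) * f h) y = x := fun t ↦ by
    simp only [map_mul, Module.End.mul_apply, ← map_sum]
    have : ∑ h, ρ (f h) y = x := by simpa [norm] using hy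
    rw [this, hx]
  rw [norm, LinearMap.sum_apply, ← hb.sum_comp, Fintype.sum_prod_type, Finset.sum_congr rfl
    fun t _ ↦ hc t, Finset.sum_const, Finset.card_univ, ← Nat.card_eq_fintype_card, hT.card_left]

lemma exists_norm_eq_of_sylow
    (h : ∀ p [Fact p.Prime] (P : Sylow p G) [Fintype P] (x : V),
      (∀ g, ρ.comp (P : Subgroup G).subtype g x = x) →
        ∃ y, norm (ρ.comp (P : Subgroup G).subtype) y = x)
    (x : V) (hx : ∀ g, ρ g x = x) : ∃ y, norm ρ y = x := by
  classical
  let R := LinearMap.range (norm ρ)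
  -- The order of x modulo norms divides the index of each Sylow subgroup, so no prime divides it.
  suffices addOrderOf (R.mkQ x) = 1 by
    rw [AddMonoid.addOrderOf_eq_one_iff] at this
    simpa [R] using this
  by_contra hne
  obtain ⟨p, hp, hdvd⟩ := Nat.exists_prime_and_dvd hne
  have := Fact.mk hp
  let P : Sylow p G := default
  obtain ⟨y, hy⟩ := h p P x (fun g ↦ hx g)
  have := ρ.norm_eq_index_nsmul (f := (P : Subgroup G).subtype)
    (Subgroup.subtype_injective _) hx hy
  rw [Subgroup.range_subtype] at this
  refine P.not_dvd_index (hdvd.trans (addOrderOf_dvd_of_nsmul_eq_zero ?_))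
  rw [← map_nsmul, ← this]
  simp [R]

end Representation

/-! ### Vanishing in two consecutive degrees forces vanishing in all degrees. -/

namespace TateCohomology

variable {k G : Type u} [CommRing k] [Group G] [Fintype G]

lemma isZero_cosyzygy_self_iff (M : Rep.{u} k G) {r s : ℤ} (hrs : r + 1 = s) :
    IsZero (tateCohomology (cosyzygy M) r) ↔ IsZero (tateCohomology M s) :=
  isZero_cosyzygy_iff M (f := .id G) Function.injective_id hrs

lemma isZero_syzygy_self_iff (M : Rep.{u} k G) {r s : ℤ} (hrs : r + 1 = s) :
    IsZero (tateCohomology M r) ↔ IsZero (tateCohomology (syzygy M) s) :=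
  isZero_syzygy_iff M (f := .id G) Function.injective_id hrs

/-- Degrees -1 and 1 are compared by elements. Vanishing over N is assumed in all degrees so that it
survives dimension shifting. -/
lemma isZero_iff_isZero_add_two_of_cyclic_quotient (N : Subgroup G) [N.Normal] [Fintype N]
    {σ : G} (hσ : ∀ x : G ⧸ N, x ∈ Subgroup.zpowers (σ : G ⧸ N)) (M : Rep.{u} k G) (r : ℤ) :
    (∀ s, IsZero (tateCohomology (Rep.res N.subtype M) s)) →
      (IsZero (tateCohomology M r) ↔ IsZero (tateCohomology M (r + 2))) := by
  refine dimension_shift (P := fun M r ↦ (∀ s, IsZero (tateCohomology (Rep.res N.subtype M) s)) →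
      (IsZero (tateCohomology M r) ↔ IsZero (tateCohomology M (r + 2)))) (-1)
    (fun M h ↦ ?_) (fun M r ih h ↦ ?_) (fun M r ih h ↦ ?_) M r
  · have h0 := (isZero_tateCohomology_zero_iff _).1 (h 0)
    have h1 := (isZero_tateCohomology_neg_one_iff _).1 (h (-1))
    have h2 := (isZero_tateCohomology_one_iff _).1 (h 1)
    rw [show (-1 + 2 : ℤ) = 1 by norm_num, isZero_tateCohomology_neg_one_iff,
      isZero_tateCohomology_one_iff]
    exact ⟨fun hG ↦ M.ρ.exists_cocycle_eq_of_cyclic_quotient hσ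
        (fun x hx ↦ h0 x fun n ↦ hx n n.2) h2 hG,
      fun hG ↦ M.ρ.mem_coinvariantsKer_of_cyclic_quotient hσ
        (fun x hx ↦ h0 x fun n ↦ hx n n.2) h1 hG⟩
  · have := ih fun s ↦ (isZero_cosyzygy_iff M N.subtype_injective rfl).2 (h (s + 1))
    rwa [isZero_cosyzygy_self_iff M rfl,
      isZero_cosyzygy_self_iff M (s := r + 1 + 2) (by ring)] at this
  · have := ih fun s ↦
      (isZero_syzygy_iff M N.subtype_injective (sub_add_cancel s 1)).1 (h _)
    rwa [← isZero_syzygy_self_iff M rfl,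
      ← isZero_syzygy_self_iff M (r := r + 2) (by ring)] at this

lemma isZero_of_isZero_sylow (M : Rep.{u} k G) (r : ℤ) :
    (∀ p [Fact p.Prime] (P : Sylow p G) [Fintype P],
      IsZero (tateCohomology (Rep.res (P : Subgroup G).subtype M) r)) →
    IsZero (tateCohomology M r) := by
  refine dimension_shift (P := fun M r ↦ (∀ p [Fact p.Prime] (P : Sylow p G) [Fintype P],
      IsZero (tateCohomology (Rep.res (P : Subgroup G).subtype M) r)) →
    IsZero (tateCohomology M r)) 0 (fun M h ↦ ?_) (fun M r ih h ↦ ?_) (fun M r ih h ↦ ?_) M r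
  · rw [isZero_tateCohomology_zero_iff]
    exact M.ρ.exists_norm_eq_of_sylow fun p _ P _ ↦ (isZero_tateCohomology_zero_iff _).1 (h p P)
  · exact (isZero_cosyzygy_self_iff M rfl).1 (ih fun p _ P _ ↦
      (isZero_cosyzygy_iff M (P : Subgroup G).subtype_injective rfl).2 (h p P))
  · exact (isZero_syzygy_self_iff M rfl).2 (ih fun p _ P _ ↦
      (isZero_syzygy_iff M (P : Subgroup G).subtype_injective rfl).1 (h p P))

/-- The `r`-th Tate cohomology of `M` vanishes for all subgroups of `G`. -/
def VanishesHereditarily {k G : Type u} [CommRing k] [Group G] (M : Rep.{u} k G) (r : ℤ) : Prop :=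
  ∀ (H : Type u) [Group H] [Fintype H] (f : H →* G), Function.Injective f →
    IsZero (tateCohomology (Rep.res f M) r)

omit [Fintype G] in
lemma VanishesHereditarily.res {M : Rep.{u} k G} {r : ℤ} (h : VanishesHereditarily M r)
    {H : Type u} [Group H] {f : H →* G} (hf : Function.Injective f) :
    VanishesHereditarily (Rep.res f M) r :=
  fun K _ _ g hg ↦ h K (f.comp g) (hf.comp hg)

/-- Induction through a normal subgroup of index p, over which all cohomology vanishes;
2-periodicity then spreads the two given degrees, one of each parity. -/
lemma isZero_of_isPGroup {p : ℕ} [Fact p.Prime] (hG : IsPGroup p G) (M : Rep.{u} k G) {a : ℤ}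
    (h₁ : VanishesHereditarily M a) (h₂ : VanishesHereditarily M (a + 1)) (r : ℤ) :
    IsZero (tateCohomology M r) := by
  classical
  obtain ⟨n, hn⟩ := IsPGroup.iff_card.1 hG
  induction n generalizing G r with
  | zero =>
    have : Subsingleton G := (Nat.card_eq_one_iff_unique.1 (by simpa using hn)).1
    exact (Representation.IsWeaklyProjective.of_subsingleton M.ρ).isZero_tateCohomology r
  | succ n ih =>
    obtain ⟨N, hN⟩ := Sylow.exists_subgroup_card_pow_prime (G := G) p
      (n := n) (hn ▸ pow_dvd_pow p n.le_succ)
    have hp : p.Prime := Fact.out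
    have hidx : N.index = p := by
      have := N.card_mul_index
      rw [hN, hn, pow_succ] at this
      exact Nat.eq_of_mul_eq_mul_left (pow_pos hp.pos n) this
    have : N.Normal := Subgroup.normal_of_index_eq_minFac_card (by
      rw [hidx, hn, hp.pow_minFac n.succ_ne_zero])
    have : IsCyclic (G ⧸ N) := isCyclic_of_prime_card (p := p) hidx
    obtain ⟨σ, hσ⟩ := IsCyclic.exists_generator (α := G ⧸ N)
    obtain ⟨σ, rfl⟩ := QuotientGroup.mk_surjective σ
    have hNM (s : ℤ) : IsZero (tateCohomology (Rep.res N.subtype M) s) :=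
      ih (hG.to_subgroup N) _ (h₁.res N.subtype_injective) (h₂.res N.subtype_injective) s hN
    have hper (s : ℤ) := isZero_iff_isZero_add_two_of_cyclic_quotient N hσ M s hNM
    have key (s : ℤ) : IsZero (tateCohomology M s) ∧ IsZero (tateCohomology M (s + 1)) := by
      induction s using Int.inductionOn' (b := a) with
      | zero => exact ⟨h₁ G (.id G) Function.injective_id, h₂ G (.id G) Function.injective_id⟩
      | succ s _ ih => exact ⟨ih.2, by simpa [add_assoc] using (hper s).1 ih.1⟩
      | pred s _ ih => exact ⟨(hper _).2 (by convert ih.2 using 2; ring), by simpa using ih.1⟩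
    exact (key r).1

theorem isZero_of_vanishesHereditarily (M : Rep.{u} k G) {a : ℤ}
    (h₁ : VanishesHereditarily M a) (h₂ : VanishesHereditarily M (a + 1)) (r : ℤ) :
    IsZero (tateCohomology M r) :=
  isZero_of_isZero_sylow M r fun _ _ P _ ↦
    isZero_of_isPGroup P.isPGroup' _ (h₁.res (P : Subgroup G).subtype_injective)
      (h₂.res (P : Subgroup G).subtype_injective) r

/-! ### Degree 0 classes as invariants modulo norms. -/

section DegreeZero

variable {k G : Type u} [CommRing k] [Group G] [Fintype G] (M : Rep.{u} k G)

lemma map_tateXZero {M N : Rep.{u} k G} (φ : M ⟶ N) (x : M.V) :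
    (tateComplex.map φ).f 0 (tateXZero M x) = tateXZero N (φ.hom x) :=
  rfl

/-- The degree `0` cycle of the Tate complex given by an invariant element. -/
noncomputable def zeroCyclesMk : ModuleCat.of k M.ρ.invariants ⟶ (tateComplex M).cycles 0 :=
  (tateComplex M).liftCycles
    (ModuleCat.ofHom ((tateXZero M).toLinearMap ∘ₗ M.ρ.invariants.subtype)) 1 (by simp) (by
      ext x
      exact (tateComplex_d_tateXZero_eq_zero_iff M _).2 x.2)

lemma iCycles_zeroCyclesMk (x : M.ρ.invariants) :
    (tateComplex M).iCycles 0 (zeroCyclesMk M x) = tateXZero M x := by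
  have h : zeroCyclesMk M ≫ (tateComplex M).iCycles 0 =
      ModuleCat.ofHom ((tateXZero M).toLinearMap ∘ₗ M.ρ.invariants.subtype) :=
    (tateComplex M).liftCycles_i _ _ _ _
  exact ConcreteCategory.congr_hom h x

lemma iCycles_injective (i : ℤ) : Function.Injective ((tateComplex M).iCycles i) :=
  (ModuleCat.mono_iff_injective _).1 inferInstance

/-- The class in degree `0` Tate cohomology of an invariant element. -/
noncomputable def zeroMk : ModuleCat.of k M.ρ.invariants ⟶ tateCohomology M 0 :=
  zeroCyclesMk M ≫ (tateComplex M).homologyπ 0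

lemma zeroMk_surjective : Function.Surjective (zeroMk M) := by
  intro y
  obtain ⟨z, rfl⟩ := (ModuleCat.epi_iff_surjective ((tateComplex M).homologyπ 0)).1 inferInstance y
  obtain ⟨v, hv⟩ := (tateXZero M).surjective ((tateComplex M).iCycles 0 z)
  have hd : (tateComplex M).d 0 1 ((tateComplex M).iCycles 0 z) = 0 :=
    ConcreteCategory.congr_hom ((tateComplex M).iCycles_d 0 1) z
  rw [← hv, tateComplex_d_tateXZero_eq_zero_iff] at hd
  refine ⟨⟨v, hd⟩, congrArg ((tateComplex M).homologyπ 0) (iCycles_injective M 0 ?_)⟩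
  rw [← hv]
  exact iCycles_zeroCyclesMk M _

lemma zeroMk_eq_zero_iff (x : M.ρ.invariants) :
    zeroMk M x = 0 ↔ ∃ y, M.ρ.norm y = x := by
  let S : ShortComplex (ModuleCat k) :=
    ShortComplex.mk _ _ ((tateComplex M).toCycles_comp_homologyπ (-1) 0)
  have hS : S.Exact := S.exact_of_g_is_cokernel
    ((tateComplex M).homologyIsCokernel (-1) 0 (by simp))
  have htoCycles (y) : (tateComplex M).iCycles 0 ((tateComplex M).toCycles (-1) 0 y) =
      (tateComplex M).d (-1) 0 y :=
    ConcreteCategory.congr_hom ((tateComplex M).toCycles_i (-1) 0) y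
  constructor
  · intro h
    obtain ⟨y, hy⟩ := (ShortComplex.moduleCat_exact_iff S).1 hS _ h
    have hy' := congrArg ((tateComplex M).iCycles 0) hy
    obtain ⟨y, rfl⟩ := (tateXNegOne M).surjective y
    refine ⟨y, (tateXZero M).injective ?_⟩
    rw [← tateComplex_d_tateXNegOne]
    exact (htoCycles _).symm.trans (hy'.trans (iCycles_zeroCyclesMk M _))
  · rintro ⟨y, hy⟩
    refine Eq.trans ?_ (ConcreteCategory.congr_hom
      ((tateComplex M).toCycles_comp_homologyπ (-1) 0) (tateXNegOne M y))
    refine congrArg ((tateComplex M).homologyπ 0) (iCycles_injective M 0 ?_)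
    refine (iCycles_zeroCyclesMk M _).trans (Eq.trans ?_ (htoCycles _).symm)
    rw [tateComplex_d_tateXNegOne, hy]

lemma map_zeroMk {M N : Rep.{u} k G} (φ : M ⟶ N) (x : M.ρ.invariants) (y : N.ρ.invariants)
    (h : φ.hom (x : M.V) = y) :
    (tateCohomologyFunctor 0).map φ (zeroMk M x) = zeroMk N y := by
  refine (ConcreteCategory.congr_hom
    (HomologicalComplex.homologyπ_naturality (tateComplex.map φ) 0) _).trans ?_
  refine congrArg ((tateComplex N).homologyπ 0) (iCycles_injective N 0 ?_)
  refine (ConcreteCategory.congr_hom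
    (HomologicalComplex.cyclesMap_i (tateComplex.map φ) 0) _).trans ?_
  refine (congrArg ((tateComplex.map φ).f 0) (iCycles_zeroCyclesMk M x)).trans ?_
  refine Eq.trans ?_ (iCycles_zeroCyclesMk N y).symm
  exact (map_tateXZero φ x.1).trans (congrArg _ h)

end DegreeZero

/-! ### Consequences of the long exact sequence. -/

section LongExact

variable {k G : Type u} [CommRing k] [Group G] [Fintype G]

instance (r : ℤ) : (tateCohomologyFunctor (R := k) (G := G) r).Additive :=
  inferInstanceAs (tateComplexFunctor k G ⋙ HomologicalComplex.homologyFunctor _ _ r).Additive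

lemma exact₂ {S : ShortComplex (Rep.{u} k G)} (hS : S.ShortExact) (r : ℤ) :
    (S.map (tateCohomologyFunctor r)).Exact :=
  (map_tateComplexFunctor_shortExact hS).homology_exact₂ r

lemma isIso_map_f {S : ShortComplex (Rep.{u} k G)} (hS : S.ShortExact)
    (h : ∀ r, IsZero (tateCohomology S.X₃ r)) (r : ℤ) :
    IsIso ((tateCohomologyFunctor r).map S.f) := by
  have : Epi ((tateCohomologyFunctor r).map S.f) :=
    (exact₂ hS r).epi_f ((h r).eq_of_tgt _ _)
  have : Mono ((tateCohomologyFunctor r).map S.f) := by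
    obtain ⟨s, rfl⟩ : ∃ s, s + 1 = r := ⟨r - 1, by ring⟩
    exact (exact₁ hS s).mono_g ((h s).eq_of_src _ _)
  exact isIso_of_mono_of_epi _

lemma isZero_X₃_zero {S : ShortComplex (Rep.{u} k G)} (hS : S.ShortExact)
    [Epi ((tateCohomologyFunctor 0).map S.f)] (h : IsZero (tateCohomology S.X₁ 1)) :
    IsZero (tateCohomology S.X₃ 0) := by
  have h0 : (tateCohomologyFunctor 0).map S.g = 0 := by
    rw [← cancel_epi ((tateCohomologyFunctor 0).map S.f), ← Functor.map_comp, S.zero]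
    simp
  have : Mono (δ hS 0) := (exact₃ hS 0).mono_g h0
  exact h.of_mono (δ hS 0)

lemma isZero_X₃_neg_one {S : ShortComplex (Rep.{u} k G)} (hS : S.ShortExact)
    [Mono ((tateCohomologyFunctor 0).map S.f)] (h : IsZero (tateCohomology S.X₂ (-1))) :
    IsZero (tateCohomology S.X₃ (-1)) := by
  have : Mono (δ hS (-1)) := (exact₃ hS (-1)).mono_g (h.eq_of_src _ _)
  have h0 : δ hS (-1) = 0 := by
    have : Mono ((tateCohomologyFunctor (-1 + 1)).map S.f) := ‹_›
    rw [← cancel_mono ((tateCohomologyFunctor (-1 + 1)).map S.f), δ_map, zero_comp]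
  exact IsZero.of_mono_eq_zero _ h0

omit [Fintype G] in
lemma isIso_map_biprod_fst (D X : Rep.{u} k G) {H : Type u} [Group H] [Fintype H] (f : H →* G)
    (r : ℤ) (h : IsZero (tateCohomology (Rep.res f X) r)) :
    IsIso ((tateCohomologyFunctor r).map ((Rep.resFunctor f).map (biprod.fst : D ⊞ X ⟶ D))) := by
  let F := Rep.resFunctor (k := k) f ⋙ tateCohomologyFunctor r
  change IsIso (F.map (biprod.fst : D ⊞ X ⟶ D))
  refine ⟨F.map biprod.inl, ?_, ?_⟩
  · have h0 : F.map (biprod.snd : D ⊞ X ⟶ X) = 0 := h.eq_of_tgt _ _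
    have := congrArg F.map (biprod.total (X := D) (Y := X))
    rw [F.map_add, F.map_comp, F.map_comp, h0, zero_comp, add_zero, F.map_id] at this
    exact this
  · rw [← F.map_comp, biprod.inl_fst, F.map_id]

end LongExact

/-! ### Trivial coefficients. -/

section Trivial

variable (k G : Type u) [CommRing k] [Group G] [Fintype G]

lemma norm_trivial (c : k) : (Rep.trivial k G k).ρ.norm c = Nat.card G * c := by
  simp [Representation.norm]

variable [CharZero k] [NoZeroDivisors k]

/-- A cocycle is a homomorphism from a finite group to a torsion-free one. -/
lemma isZero_tateCohomology_trivial_one : IsZero (tateCohomology (Rep.trivial k G k) 1) := by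
  rw [isZero_tateCohomology_one_iff]
  intro f hf
  let F : Additive G →+ k := AddMonoidHom.mk' (fun g ↦ f g.toMul) fun a b ↦ by
    simpa [add_comm] using hf a.toMul b.toMul
  refine ⟨0, fun g ↦ ?_⟩
  have h : F (Nat.card G • Additive.ofMul g) = 0 := by
    rw [← ofMul_pow, pow_card_eq_one']
    exact F.map_zero
  rw [map_nsmul, nsmul_eq_mul, mul_eq_zero] at h
  simpa [F] using h.resolve_left (Nat.cast_ne_zero.2 Nat.card_pos.ne')

end Trivial

/-! ### The comparison map given by a generator in degree 0. -/

section Generator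

variable {k G : Type u} [CommRing k] [Group G] [Fintype G] {D : Rep.{u} k G}

/-- The morphism from the trivial representation given by an invariant element. -/
def ofInvariant (x : D.ρ.invariants) : Rep.trivial k G k ⟶ D :=
  Rep.ofHom ⟨LinearMap.toSpanSingleton k D.V x, fun g ↦ by
    ext
    simpa using (x.2 g).symm⟩

variable {H : Type u} [Group H] [Fintype H] {f : H →* G}

/-- If nx is the H-norm of y, the G-norm of y is [G:H]nx, so |G| divides [G:H]n. -/
lemma card_dvd_of_nsmul_zeroMk_res_eq_zero (hf : Function.Injective f) (x : D.ρ.invariants)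
    (hx : addOrderOf (zeroMk D x) = Nat.card G) (x' : (Rep.res f D).ρ.invariants)
    (hx' : (x' : D.V) = x) (n : ℕ) (hn : n • zeroMk (Rep.res f D) x' = 0) : Nat.card H ∣ n := by
  rw [← map_nsmul, zeroMk_eq_zero_iff] at hn
  obtain ⟨y, hy⟩ := hn
  have h := D.ρ.norm_eq_index_nsmul hf (x := n • (x : D.V)) (fun g ↦ by rw [map_nsmul, x.2 g])
    (hy.trans (by rw [← hx']; rfl))
  have h0 : (f.range.index * n) • zeroMk D x = 0 := by
    rw [← map_nsmul, zeroMk_eq_zero_iff]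
    exact ⟨y, h.trans (by rw [mul_smul]; rfl)⟩
  have := addOrderOf_dvd_of_nsmul_eq_zero h0
  rw [hx, ← f.range.index_mul_card, ← Nat.card_congr (MonoidHom.ofInjective hf).toEquiv] at this
  exact Nat.dvd_of_mul_dvd_mul_left (Nat.pos_of_ne_zero Subgroup.index_ne_zero_of_finite) this

lemma isIso_map_res_ofInvariant (hk : Function.Surjective (Int.cast : ℤ → k))
    (hf : Function.Injective f) (x : D.ρ.invariants)
    (hx : addOrderOf (zeroMk D x) = Nat.card G)
    (e : tateCohomology (Rep.res f D) 0 ≃+ ZMod (Nat.card H)) :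
    IsIso ((tateCohomologyFunctor 0).map ((Rep.resFunctor f).map (ofInvariant x))) := by
  let x' : (Rep.res f D).ρ.invariants := ⟨x, fun h ↦ x.2 (f h)⟩
  let one (c : k) : (Rep.trivial k H k).ρ.invariants := ⟨c, fun _ ↦ rfl⟩
  have hmap (n : ℤ) : (tateCohomologyFunctor 0).map ((Rep.resFunctor f).map (ofInvariant x))
      (zeroMk (Rep.trivial k H k) (one n)) = n • zeroMk (Rep.res f D) x' := by
    rw [← map_zsmul]
    exact map_zeroMk _ _ _ (Int.cast_smul_eq_zsmul k n (x : D.V))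
  have hdvd (n : ℕ) := card_dvd_of_nsmul_zeroMk_res_eq_zero hf x hx x' rfl n
  -- Only the cardinality is taken from `e`; no compatibility with restriction is needed, since a
  -- class of order |H| in a group of order |H| generates it.
  have : Finite (tateCohomology (Rep.res f D) 0) := Finite.of_equiv _ e.symm.toEquiv
  have hcard : Nat.card (tateCohomology (Rep.res f D) 0) = Nat.card H := by
    rw [Nat.card_congr e.toEquiv, Nat.card_zmod]
  have hord : addOrderOf (zeroMk (Rep.res f D) x') = Nat.card H :=
    Nat.dvd_antisymm (hcard ▸ addOrderOf_dvd_natCard _) (hdvd _ (addOrderOf_nsmul_eq_zero _))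
  rw [ConcreteCategory.isIso_iff_bijective]
  refine ⟨(injective_iff_map_eq_zero _).2 fun z hz ↦ ?_, fun z ↦ ?_⟩
  · obtain ⟨⟨c, hc⟩, rfl⟩ := zeroMk_surjective (Rep.trivial k H k) z
    obtain ⟨n, rfl⟩ := hk c
    have h0 : n • zeroMk (Rep.res f D) x' = 0 := (hmap n).symm.trans hz
    rw [← addOrderOf_dvd_iff_zsmul_eq_zero, hord] at h0
    obtain ⟨m, rfl⟩ := h0
    exact (zeroMk_eq_zero_iff _ _).2 ⟨(m : k), (norm_trivial k H m).trans (by simp)⟩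
  · have hz : z ∈ AddSubgroup.zmultiples (zeroMk (Rep.res f D) x') := by
      rw [AddSubgroup.eq_top_of_card_eq (AddSubgroup.zmultiples (zeroMk (Rep.res f D) x'))
        (by rw [Nat.card_zmultiples, hord, hcard])]
      trivial
    obtain ⟨n, rfl⟩ := hz
    exact ⟨_, hmap n⟩

omit [Fintype G] in
lemma vanishesHereditarily_cokernel_of_isIso {S : ShortComplex (Rep.{u} k G)} (hS : S.ShortExact)
    (h : ∀ (H : Type u) [Group H] [Fintype H] (f : H →* G), Function.Injective f →
      IsIso ((tateCohomologyFunctor 0).map ((Rep.resFunctor f).map S.f)))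
    (h₁ : VanishesHereditarily S.X₁ 1) (h₂ : VanishesHereditarily S.X₂ (-1)) :
    VanishesHereditarily S.X₃ (-1) ∧ VanishesHereditarily S.X₃ 0 := by
  have hS' {H : Type u} [Group H] (f : H →* G) := (Rep.shortExact_res f).2 hS
  refine ⟨fun H _ _ f hf ↦ ?_, fun H _ _ f hf ↦ ?_⟩
  · have := h H f hf
    have : Mono ((tateCohomologyFunctor 0).map (S.map (Rep.resFunctor f)).f) :=
      inferInstanceAs (Mono ((tateCohomologyFunctor 0).map ((Rep.resFunctor f).map S.f)))
    exact isZero_X₃_neg_one (S := S.map (Rep.resFunctor f)) (hS' f) (h₂ H f hf)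
  · have := h H f hf
    have : Epi ((tateCohomologyFunctor 0).map (S.map (Rep.resFunctor f)).f) :=
      inferInstanceAs (Epi ((tateCohomologyFunctor 0).map ((Rep.resFunctor f).map S.f)))
    exact isZero_X₃_zero (S := S.map (Rep.resFunctor f)) (hS' f) (h₁ H f hf)

theorem nonempty_iso_trivial [CharZero k] [NoZeroDivisors k]
    (hk : Function.Surjective (Int.cast : ℤ → k)) (hD : VanishesHereditarily D (-1))
    (h0 : ∀ (H : Type u) [Group H] [Fintype H] (f : H →* G), Function.Injective f →
      Nonempty (tateCohomology (Rep.res f D) 0 ≃+ ZMod (Nat.card H))) (r : ℤ) :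
    Nonempty (tateCohomology (Rep.trivial k G k) r ≅ tateCohomology D r) := by
  obtain ⟨e⟩ := h0 G (.id G) Function.injective_id
  obtain ⟨x, hx⟩ := zeroMk_surjective D (e.symm 1)
  have hord : addOrderOf (zeroMk D x) = Nat.card G := by
    rw [hx]
    exact (e.symm.addOrderOf_eq 1).trans (ZMod.addOrderOf_one _)
  let Z := Rep.trivial k G k
  let X := diagonalFunctions Z
  have hX : X.ρ.IsWeaklyProjective := isWeaklyProjective_diagonalFunctions Z
  -- The second component makes ψ injective, while X contributes no cohomology over any subgroup.
  let ψ : Z ⟶ D ⊞ X := biprod.lift (ofInvariant x) (diagonalConst Z)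
  have hψ : ψ ≫ biprod.fst = ofInvariant x := biprod.lift_fst _ _
  have : Mono ψ := by
    have : Mono (ψ ≫ biprod.snd) := by
      rw [show ψ ≫ biprod.snd = diagonalConst Z from biprod.lift_snd _ _]
      infer_instance
    exact mono_of_mono ψ biprod.snd
  have hS : (ShortComplex.mk ψ _ (cokernel.condition ψ)).ShortExact :=
    { exact := ShortComplex.exact_cokernel _ }
  have hfst (H : Type u) [Group H] [Fintype H] (f : H →* G) (hf : Function.Injective f) (s : ℤ) :=
    isIso_map_biprod_fst D X f s ((hX.comp hf).isZero_tateCohomology s)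
  have hψ₀ (H : Type u) [Group H] [Fintype H] (f : H →* G) (hf : Function.Injective f) :
      IsIso ((tateCohomologyFunctor 0).map ((Rep.resFunctor f).map ψ)) := by
    have := hfst H f hf 0
    have := isIso_map_res_ofInvariant hk hf x hord (h0 H f hf).some
    rw [← hψ, Functor.map_comp, Functor.map_comp] at this
    exact IsIso.of_isIso_comp_right _
      ((tateCohomologyFunctor 0).map ((Rep.resFunctor f).map (biprod.fst : D ⊞ X ⟶ D)))
  obtain ⟨hQ₁, hQ₀⟩ := vanishesHereditarily_cokernel_of_isIso hS hψ₀
    (fun H _ _ f _ ↦ isZero_tateCohomology_trivial_one k H)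
    (fun H _ _ f hf ↦ by
      have := hfst H f hf (-1)
      exact (hD H f hf).of_iso (asIso ((tateCohomologyFunctor (-1)).map
        ((Rep.resFunctor f).map (biprod.fst : D ⊞ X ⟶ D)))))
  have h1 : IsIso ((tateCohomologyFunctor r).map ψ) :=
    isIso_map_f hS (isZero_of_vanishesHereditarily _ hQ₁ hQ₀) r
  have h2 : IsIso ((tateCohomologyFunctor r).map (biprod.fst : D ⊞ X ⟶ D)) :=
    hfst G (.id G) Function.injective_id r
  exact ⟨asIso ((tateCohomologyFunctor r).map ψ) ≪≫ asIso ((tateCohomologyFunctor r).map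
    (biprod.fst : D ⊞ X ⟶ D))⟩

end Generator

/-- Restricting along an injective homomorphism amounts to restricting to its range. -/
noncomputable def groupCohomologyResIso {k G H : Type u} [CommRing k] [Group G] [Group H]
    (M : Rep.{u} k G) {f : H →* G} (hf : Function.Injective f) (n : ℕ) :
    groupCohomology (Rep.res f M) n ≅ groupCohomology (Rep.res f.range.subtype M) n :=
  groupCohomology.mapIso (MonoidHom.ofInjective hf) (LinearEquiv.refl k M.V) (fun _ ↦ rfl) n

end TateCohomology

/-! ### Tate's theorem. -/

open TateCohomology in
theorem mainTheorem2 (G : Type) [Group G] [Fintype G] (C : Rep.{0} ℤ G)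
    (h1 : ∀ H : Subgroup G, Subsingleton (groupCohomology (Rep.res H.subtype C) 1))
    (h2 : ∀ H : Subgroup G,
      Nonempty (groupCohomology (Rep.res H.subtype C) 2 ≃+ ZMod (Nat.card H))) :
    ∀ r : ℤ, Nonempty (tateCohomology (Rep.trivial ℤ G ℤ) r ≃+ tateCohomology C (r + 2)) := by
  intro r
  -- Shifting by two turns the hypotheses on H¹ and H² of `C` into statements about degrees -1 and 0
  -- of `D`.
  let D := cosyzygy (cosyzygy C)
  have shift {H : Type} [Group H] [Fintype H] {f : H →* G} (hf : Function.Injective f) {s t : ℤ}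
      (hst : s + 2 = t) :
      Nonempty (tateCohomology (Rep.res f D) s ≅ tateCohomology (Rep.res f C) t) :=
    ⟨(nonempty_iso_cosyzygy _ hf rfl).some ≪≫
      (nonempty_iso_cosyzygy C hf (by rw [← hst]; ring)).some⟩
  have hD₁ : VanishesHereditarily D (-1) := fun H _ _ f hf ↦ by
    have := (ModuleCat.isZero_iff_subsingleton
      (M := groupCohomology (Rep.res f.range.subtype C) 1)).2 (h1 f.range)
    exact this.of_iso ((shift hf (t := 1) (by norm_num)).some ≪≫
      (isoGroupCohomology 1).app _ ≪≫ groupCohomologyResIso C hf 1)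
  have hD₀ (H : Type) [Group H] [Fintype H] (f : H →* G) (hf : Function.Injective f) :
      Nonempty (tateCohomology (Rep.res f D) 0 ≃+ ZMod (Nat.card H)) := by
    obtain ⟨e⟩ := h2 f.range
    rw [← Nat.card_congr (MonoidHom.ofInjective hf).toEquiv] at e
    exact ⟨((shift hf (t := 2) (by norm_num)).some ≪≫ (isoGroupCohomology 2).app _ ≪≫
      groupCohomologyResIso C hf 2).toLinearEquiv.toAddEquiv.trans e⟩
  exact ⟨((nonempty_iso_trivial (fun n ↦ ⟨n, Int.cast_id⟩) hD₁ hD₀ r).some ≪≫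
    (shift (f := .id G) Function.injective_id rfl).some).toLinearEquiv.toAddEquiv⟩
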